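/- **Theorem (traversal preserved by the container isomorphism).** An applicative functor is a lax monoidal functor $F:\mathbf{Set}\to\mathbf{Set}$ with respect to $(\times,1)$, with unit $u\in F1$ and action $\star: FX\times FY\to F(X\times Y)$ (equivalently, a lawful $\mathrm{pure}$/$\circledast$ structure). A functor $T:\mathbf{Set}\to\mathbf{Set}$ is traversable if it is equipped with a family $\mathrm{traverse}_{F,A,B}:(A\to FB)\to TA\to F(TB)$, natural in $A$, $B$ and (for applicative morphisms) in the applicative functor $F$, such that $\mathrm{traverse}_{FG}(Fg\circ f)=F(\mathrm{traverse}_G\,g)\circ\mathrm{traverse}_F\,f$ (linearity) and $\mathrm{traverse}_{\mathrm{Id}}(\mathrm{id}_A)=\mathrm{id}_{TA}$ (unity). For sets $A,B$ let $R^*_{A,B}X=\sum_{n\in\mathbb N}A^n\times(B^n\to X)$, the applicative functor with $R^*_{A,B}(h)(n,as,g)=(n,as,h\circ g)$, $u=(0,*,\lambda bs.\,*)$ and $(n,as,f)\star(m,as',g)=(n+m,\,as\mathbin{+\!\!+}as',\,\lambda bs.\,(f(\mathrm{take}\,n\,bs),g(\mathrm{drop}\,n\,bs)))$. Put $\dim(n,as,g)=n$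 and $\mathrm{wrap}_{A,B}\,a=(1,a,\mathrm{id}_B)\in R^*_{A,B}B$, so that $\mathrm{traverse}\,\mathrm{wrap}_{A,B}:TA\to R^*_{A,B}(TB)$. A finitary container is a set $S$ with a function $ar:S\to\mathbb N$; its extension is the functor $[\![S,ar]\!]X=\sum_{s\in S}X^{ar(s)}$, and its canonical traversal is $\mathrm{traverse}\,f\,(s,xs)=F(\lambda c.\,(s,c))(\mathrm{collect}_{ar(s)}\,f\,xs)$, where $\mathrm{collect}_n\,f\,(x_1,\dots,x_n)=f(x_1)\star\cdots\star f(x_n)\in F(B^n)$ (for $n=0$ it is $u$). Let $T$ be a traversable functor. For every set $X$ define $$\Phi_X: TX\to[\![T1,\ \lambda s.\dim(\mathrm{traverse}\,\mathrm{wrap}_{1,1}\,s)]\!]X,\qquad \Phi_X(x)=(g(*^n),\,i)\ \text{ where }(n,i,g)=\mathrm{traverse}\,\mathrm{wrap}_{X,1}\,x$$ and $*^n$ is the unique element of $1^n$. (The arity of the shape $g(*^n)$ is $n$, so this is well defined.) Then every $\Phi_X$ is a bijection, and for every applicative functor $F$, all sets $A,B$, every $f:A\to FB$ and every $x\in TA$,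 $$F(\Phi_B)\,(\mathrm{traverse}\,f\,x)=\mathrm{traverse}\,f\,(\Phi_A\,x),$$ where $\mathrm{traverse}$ on the left is the given traversal of $T$ and on the right is the canonical traversal of the container. That is, the isomorphism $\Phi$ carries the given traversal of $T$ to the canonical one. -/

import Mathlib

universe u

namespace TraversableContainer

section Monoidal

variable {F : Type u → Type u} [Applicative F]

/-- The monoidal action `F X × F Y → F (X × Y)` of an applicative functor. (The monoidal unit
is `pure PUnit.unit`.) -/
def starProd {X Y : Type u} (x : F X) (y : F Y) : F (X × Y) :=
  Prod.mk <$> x <*> y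

/-- `collect n f (x₁, …, xₙ) = f x₁ ⋆ ⋯ ⋆ f xₙ`, where the iterated product is read as a vector
of length `n`; for `n = 0` it is the monoidal unit, read as the empty vector. -/
def collect {A B : Type u} (f : A → F B) : (n : ℕ) → (Fin n → A) → F (Fin n → B)
  | 0, _ => pure Fin.elim0
  | n + 1, xs =>
    (fun p : B × (Fin n → B) => (Fin.cons p.1 p.2 : Fin (n + 1) → B)) <$>
      starProd (f (xs 0)) (collect f n (fun i => xs i.succ))

end Monoidal

/-- The functor `R*_{A,B}`, `R*_{A,B} X = Σ n : ℕ, Aⁿ × (Bⁿ → X)`, the free applicative functor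
on the functor `X ↦ A × (B → X)`. -/
@[ext]
structure FreeApp (A B X : Type u) : Type u where
  /-- the dimension -/
  dim : ℕ
  /-- the position -/
  pos : Fin dim → A
  /-- peeking into a new position -/
  peek : (Fin dim → B) → X

namespace FreeApp

variable {A B C X Y : Type u}

/-- The action on morphisms, `(n, as, g) ↦ (n, as, h ∘ g)`. -/
def map (h : X → Y) (r : FreeApp A B X) : FreeApp A B Y :=
  ⟨r.dim, r.pos, h ∘ r.peek⟩

/-- `(n, as, f) ⋆ (m, as', g) = (n + m, as ++ as', bs ↦ (f (take n bs), g (drop n bs)))`. -/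
def mul (r : FreeApp A B X) (s : FreeApp A B Y) : FreeApp A B (X × Y) :=
  ⟨r.dim + s.dim, Fin.append r.pos s.pos,
    fun bs => (r.peek fun i => bs (Fin.castAdd s.dim i), s.peek fun i => bs (Fin.natAdd r.dim i))⟩

/-- The applicative structure obtained from the monoidal one: `pure x` is the image of the
monoidal unit `(0, *, bs ↦ *)` under the constant map `x`, and `r <*> s` is the image of `r ⋆ s`
under evaluation. -/
instance : Applicative (FreeApp A B) where
  map := map
  pure x := ⟨0, Fin.elim0, fun _ => x⟩
  seq r s := map (fun p => p.1 p.2) (mul r (s ()))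

theorem map_def (h : X → Y) (r : FreeApp A B X) : h <$> r = ⟨r.dim, r.pos, h ∘ r.peek⟩ := rfl

theorem pure_def (x : X) : (pure x : FreeApp A B X) = ⟨0, Fin.elim0, fun _ => x⟩ := rfl

theorem seq_def (r : FreeApp A B (X → Y)) (s : FreeApp A B X) :
    r <*> s = ⟨r.dim + s.dim, Fin.append r.pos s.pos,
      fun bs => r.peek (fun i => bs (Fin.castAdd s.dim i))
        (s.peek fun i => bs (Fin.natAdd r.dim i))⟩ := rfl

theorem ext_cast {r s : FreeApp A B X} (h : r.dim = s.dim)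
    (hp : ∀ i, r.pos i = s.pos (Fin.cast h i))
    (hk : ∀ bs, r.peek (fun i => bs (Fin.cast h i)) = s.peek bs) : r = s := by
  obtain ⟨n, p, k⟩ := r
  obtain ⟨m, q, l⟩ := s
  obtain rfl : n = m := h
  have h1 : p = q := funext hp
  have h2 : k = l := funext hk
  rw [h1, h2]

instance : LawfulApplicative (FreeApp A B) where
  map_const := rfl
  id_map _ := rfl
  comp_map _ _ _ := rfl
  seqLeft_eq _ _ := rfl
  seqRight_eq _ _ := rfl
  pure_seq g x := by
    refine ext_cast (Nat.zero_add _) (fun i => ?_) (fun bs => ?_)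
    · simp only [pure_def, seq_def, map_def]
      rw [Fin.append_left_nil _ _ rfl]
      rfl
    · simp only [pure_def, seq_def, map_def]
      congr 2
      funext i
      congr 1
      ext
      simp
  map_pure _ _ := rfl
  seq_pure g x := by
    refine ext_cast (Nat.add_zero _) (fun i => ?_) (fun bs => ?_)
    · simp only [pure_def, seq_def, map_def]
      rw [Fin.append_right_nil _ _ rfl]
      rfl
    · rfl
  seq_assoc x g h := by
    refine ext_cast (Nat.add_assoc _ _ _).symm (fun i => ?_) (fun bs => ?_)
    · simp only [seq_def, map_def]
      rw [Fin.append_assoc]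
      rfl
    · simp only [seq_def, map_def, Function.comp_apply]
      have h1 : ∀ i : Fin h.dim, Fin.cast (Nat.add_assoc h.dim g.dim x.dim).symm
          (Fin.castAdd (g.dim + x.dim) i) = Fin.castAdd x.dim (Fin.castAdd g.dim i) :=
        fun i => Fin.ext rfl
      have h2 : ∀ i : Fin g.dim, Fin.cast (Nat.add_assoc h.dim g.dim x.dim).symm
          (Fin.natAdd h.dim (Fin.castAdd x.dim i)) = Fin.castAdd x.dim (Fin.natAdd h.dim i) :=
        fun i => Fin.ext rfl
      have h3 : ∀ i : Fin x.dim, Fin.cast (Nat.add_assoc h.dim g.dim x.dim).symm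
          (Fin.natAdd h.dim (Fin.natAdd g.dim i)) = Fin.natAdd (h.dim + g.dim) i :=
        fun i => Fin.ext (Nat.add_assoc _ _ _).symm
      exact congr (congrArg h.peek (funext fun i => congrArg bs (h1 i)))
        (congr (congrArg g.peek (funext fun i => congrArg bs (h2 i)))
          (congrArg x.peek (funext fun i => congrArg bs (h3 i))))

/-- `wrap a = (1, a, id)`, with `X¹` read as functions on `Fin 1`. -/
def wrap (A B : Type u) (a : A) : FreeApp A B B :=
  ⟨1, fun _ => a, fun bs => bs 0⟩

/-- The comultiplication `(n, as, g) ↦ (n, as, bs ↦ (n, bs, g))`, an applicative morphism. -/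
def comult (A B C : Type u) :
    ApplicativeTransformation (FreeApp A C) (Functor.Comp (FreeApp A B) (FreeApp B C)) where
  app _ r := Functor.Comp.mk ⟨r.dim, r.pos, fun bs => ⟨r.dim, bs, r.peek⟩⟩
  preserves_pure' x := by
    refine congrArg Functor.Comp.mk (ext_cast rfl (fun _ => rfl) fun bs => ?_)
    exact ext_cast rfl (fun i => i.elim0) fun _ => rfl
  preserves_seq' r s := by
    refine congrArg Functor.Comp.mk (ext_cast rfl (fun _ => rfl) fun bs => ?_)
    refine ext_cast rfl (fun i => ?_) fun _ => rfl
    exact (congrFun (Fin.append_castAdd_natAdd (f := bs)) i).symm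

end FreeApp

/-- A finitary container: a set of shapes and an arity function. -/
structure FinContainer : Type (u + 1) where
  Shape : Type u
  arity : Shape → ℕ

/-- The extension `X ↦ Σ s : S, X ^ (ar s)` of a finitary container `(S, ar)`. -/
def FinContainer.Ext (C : FinContainer.{u}) (X : Type u) : Type u :=
  Σ s : C.Shape, (Fin (C.arity s) → X)

/-- The extension of a finitary container, with its action on morphisms and its canonical
traversal. -/
instance (C : FinContainer.{u}) : Traversable C.Ext where
  map h c := ⟨c.1, h ∘ c.2⟩
  traverse f c := (fun ys => (⟨c.1, ys⟩ : C.Ext _)) <$> collect f (C.arity c.1) c.2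

section Traversal

variable (T : Type u → Type u) [Traversable T]

/-- The coalgebra `t_{A,B} = traverse wrap_{A,B} : T A → R*_{A,B} (T B)` of a traversal. -/
def coalg {A : Type u} (B : Type u) (x : T A) : FreeApp A B (T B) :=
  traverse (FreeApp.wrap A B) x

/-- The finitary container of shapes `T 1` and arities `s ↦ dim (traverse wrap s)`. -/
def containerOf : FinContainer.{u} where
  Shape := T PUnit
  arity s := (coalg T PUnit s).dim

variable [LawfulTraversable T]

theorem comult_coalg {A : Type u} (B C : Type u) (x : T A) :
    FreeApp.comult A B C (coalg T C x) = Functor.Comp.mk (coalg T C <$> coalg T B x) := by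
  have h := LawfulTraversable.comp_traverse (FreeApp.wrap B C) (FreeApp.wrap A B) x
  unfold coalg
  rw [LawfulTraversable.naturality]
  refine Eq.trans ?_ h
  congr 1
  funext a
  refine congrArg Functor.Comp.mk (FreeApp.ext_cast rfl (fun _ => rfl) fun bs => ?_)
  refine FreeApp.ext_cast rfl (fun i => ?_) fun _ => rfl
  exact congrArg bs (Subsingleton.elim (α := Fin 1) _ _)

theorem dim_coalg_peek {A B : Type u} (C : Type u) (x : T A)
    (bs : Fin (coalg T B x).dim → B) :
    (coalg T C ((coalg T B x).peek bs)).dim = (coalg T C x).dim := by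
  have key : ∀ r s : FreeApp A B (FreeApp B C (T C)), r = s →
      (∀ v, (r.peek v).dim = (coalg T C x).dim) →
      ∀ v, (s.peek v).dim = (coalg T C x).dim := by
    rintro r _ rfl h
    exact h
  exact key _ _ (comult_coalg T B C x) (fun _ => rfl) bs

/-- `Φ x = (g (*ⁿ), i)` for `(n, i, g) = traverse wrap x`. The arity of the shape `g (*ⁿ)` equals
`n` by a theorem only, so the vector `i` is reindexed along that equality. -/
def Phi {X : Type u} (x : T X) : (containerOf T).Ext X :=
  ⟨(coalg T PUnit x).peek fun _ => PUnit.unit,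
    fun j => (coalg T PUnit x).pos (Fin.cast (dim_coalg_peek T PUnit x _) j)⟩

end Traversal

end TraversableContainer

namespace TraversableContainer

section Collect

variable {F : Type u → Type u} [Applicative F] [LawfulApplicative F] {A B X Y : Type u}

/-! `FreeApp A B` is free: each `f : A → F B` extends along `wrap` to an applicative morphism `lift
f`. Naturality in the applicative functor then reduces every traversal to the coalgebra: if `coalg T
B x = (n, as, g)`, then `traverse f x` is `g` mapped over `collect f n as`.

Unity gives `g as = x` when `B = A`. Linearity (`exists_coalg_eq`) says that `n` and `as` do not
depend on `B`, and that refilling changes only the contents: `coalg T C (g bs) = (n, bs, k)` with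
the same `k` as for `x`. So a shape determines its refilling function, which makes `Phi` bijective,
and `Phi (g bs)` is the shape of `x` filled with `bs`, which turns the factored traversal into the
canonical one. -/

theorem collect_succ (f : A → F B) (n : ℕ) (xs : Fin (n + 1) → A) :
    collect f (n + 1) xs =
      (fun b (bs : Fin n → B) => (Fin.cons b bs : Fin (n + 1) → B)) <$> f (xs 0) <*>
        collect f n (fun i => xs i.succ) := by
  simp only [collect, starProd, map_seq, Functor.map_map]
  rfl

theorem collect_cast (f : A → F B) {n m : ℕ} (h : n = m) (xs : Fin n → A) :
    collect f n xs =
      (fun bs i => bs (Fin.cast h i)) <$> collect f m (fun i => xs (Fin.cast h.symm i)) := by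
  subst h
  exact (id_map _).symm

/-- Associativity of the action, by induction on `n`; this is what makes `lift f` preserve `<*>`. -/
theorem collect_append (f : A → F B) (n m : ℕ) (xs : Fin n → A) (ys : Fin m → A) :
    collect f (n + m) (Fin.append xs ys) =
      Fin.append <$> collect f n xs <*> collect f m ys := by
  induction n with
  | zero =>
    rw [collect_cast f (Nat.zero_add m), collect, map_pure, pure_seq]
    have h : (fun i => Fin.append xs ys (Fin.cast (Nat.zero_add m).symm i)) = ys := by
      funext i
      rw [Fin.append_left_nil _ _ rfl]
      rfl
    rw [h]
    congr 1
    funext bs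
    exact (Fin.append_left_nil _ _ rfl).symm
  | succ n ih =>
    rw [collect_cast f (Nat.succ_add n m), collect_succ, collect_succ]
    have h0 : Fin.append xs ys (Fin.cast (Nat.succ_add n m).symm 0) = xs 0 :=
      Fin.append_left xs ys 0
    have hs : (fun i : Fin (n + m) =>
        Fin.append xs ys (Fin.cast (Nat.succ_add n m).symm i.succ)) =
          Fin.append (fun i => xs i.succ) ys := by
      funext i
      refine Fin.addCases (fun j => ?_) (fun j => ?_) i
      · rw [Fin.append_left]
        exact Fin.append_left xs ys j.succ
      · rw [Fin.append_right, ← Fin.append_right xs ys j]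
        congr 1
        ext
        simp only [Fin.val_cast, Fin.val_succ, Fin.val_natAdd]
        omega
    rw [h0, hs, ih]
    simp only [map_seq, seq_assoc, Functor.map_map, seq_map_assoc]
    congr 2
    congr 1
    funext b bs cs i
    refine Fin.addCases (fun j => ?_) (fun j => ?_) i
    · refine Fin.cases ?_ (fun k => ?_) j
      · exact (Fin.append_left (Fin.cons b bs : Fin (n + 1) → B) cs 0).symm
      · refine Eq.trans ?_ (Fin.append_left (Fin.cons b bs : Fin (n + 1) → B) cs k.succ).symm
        exact Fin.append_left bs cs k
    · refine Eq.trans ?_ (Fin.append_right (Fin.cons b bs : Fin (n + 1) → B) cs j).symm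
      have h : Fin.cast (Nat.succ_add n m) (Fin.natAdd (n + 1) j) = (Fin.natAdd n j).succ := by
        ext
        simp only [Fin.val_cast, Fin.val_succ, Fin.val_natAdd]
        omega
      simp only [Function.comp_apply, h, Fin.cons_succ, Fin.append_right]

theorem collect_one (f : A → F B) (xs : Fin 1 → A) :
    collect f 1 xs = (fun b _ => b) <$> f (xs 0) := by
  rw [collect_succ, collect, seq_pure, Functor.map_map]
  congr 1
  funext b i
  obtain rfl : i = 0 := Fin.ext (Nat.lt_one_iff.mp i.isLt)
  rfl

theorem collect_id_pure (n : ℕ) (xs : Fin n → A) :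
    collect (pure : A → Id A) n xs = xs := by
  induction n with
  | zero => exact funext fun i => i.elim0
  | succ n ih =>
    rw [collect_succ, ih]
    exact Fin.cons_self_tail xs

/-- The applicative morphism out of the free applicative functor determined by `f`. -/
def FreeApp.lift (f : A → F B) : ApplicativeTransformation (FreeApp A B) F where
  app _ r := r.peek <$> collect f r.dim r.pos
  preserves_pure' x := by
    simp only [FreeApp.pure_def, collect, map_pure]
  preserves_seq' r s := by
    simp only [FreeApp.seq_def, collect_append, map_seq, Functor.map_map, seq_map_assoc]
    congr 2
    funext bs cs
    simp only [Function.comp_apply, Fin.append_left, Fin.append_right]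

theorem FreeApp.lift_apply (f : A → F B) (r : FreeApp A B X) :
    FreeApp.lift f r = r.peek <$> collect f r.dim r.pos := rfl

theorem FreeApp.lift_wrap (f : A → F B) (a : A) :
    FreeApp.lift f (FreeApp.wrap A B a) = f a := by
  simp only [FreeApp.lift_apply, FreeApp.wrap, collect_one, Functor.map_map]
  exact id_map _

end Collect

/-- Comparing indices by value avoids transporting vectors along an equality of shapes. -/
theorem FinContainer.ext_of_val {C : FinContainer.{u}} {X : Type u} {c d : C.Ext X}
    (h : c.1 = d.1) (h' : ∀ i j, i.val = j.val → c.2 i = d.2 j) : c = d := by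
  obtain ⟨s, v⟩ := c
  obtain ⟨s', w⟩ := d
  obtain rfl : s = s' := h
  obtain rfl : v = w := funext fun i => h' i i rfl
  rfl

/-! ### The coalgebra laws and the isomorphism `Phi` -/

section Traversal

variable (T : Type u → Type u) [Traversable T] [LawfulTraversable T]

/-- Every traversal factors through the coalgebra. -/
theorem traverse_eq_map_collect {F : Type u → Type u} [Applicative F] [LawfulApplicative F]
    {A B : Type u} (f : A → F B) (x : T A) :
    traverse f x =
      (coalg T B x).peek <$> collect f (coalg T B x).dim (coalg T B x).pos := by
  rw [← FreeApp.lift_apply, coalg, LawfulTraversable.naturality]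
  congr 1
  funext a
  exact (FreeApp.lift_wrap f a).symm

theorem peek_pos_coalg {A : Type u} (x : T A) :
    (coalg T A x).peek (coalg T A x).pos = x := by
  -- Unity is the factorization for the identity functor, where collecting returns the vector
  -- itself.
  have h := traverse_eq_map_collect T (pure : A → Id A) x
  rw [collect_id_pure, LawfulTraversable.id_traverse] at h
  exact h.symm

/-- The comultiplication law of the coalgebra in components. -/
theorem exists_coalg_eq {A : Type u} (B C : Type u) (x : T A) :
    ∃ (n : ℕ) (as : Fin n → A) (g : (Fin n → B) → T B) (k : (Fin n → C) → T C),
      coalg T B x = ⟨n, as, g⟩ ∧ coalg T C x = ⟨n, as, k⟩ ∧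
        ∀ bs, coalg T C (g bs) = ⟨n, bs, k⟩ := by
  have h := comult_coalg T B C x
  -- With both coalgebra values made variables, their dimensions can be identified by substitution.
  generalize coalg T C x = r at h ⊢
  generalize coalg T B x = s at h ⊢
  obtain ⟨n, p, k⟩ := r
  obtain ⟨m, q, g⟩ := s
  have h1 : (⟨n, p, fun bs => ⟨n, bs, k⟩⟩ : FreeApp A B (FreeApp B C (T C))) =
    ⟨m, q, coalg T C ∘ g⟩ := h
  injection h1 with hn hp hg
  subst hn
  obtain rfl := eq_of_heq hp
  exact ⟨n, p, g, k, rfl, rfl, fun bs => (congrFun (eq_of_heq hg) bs).symm⟩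

theorem Phi_eq_of_coalg_eq {X : Type u} {x : T X} {n : ℕ} {v : Fin n → X}
    {g : (Fin n → PUnit) → T PUnit} (hx : coalg T PUnit x = ⟨n, v, g⟩)
    {c : (containerOf T).Ext X} (hs : g (fun _ => PUnit.unit) = c.1)
    (hv : ∀ i j, i.val = j.val → v i = c.2 j) : Phi T x = c := by
  have key : ∀ r : FreeApp X PUnit (T PUnit), r = ⟨n, v, g⟩ →
      r.peek (fun _ => PUnit.unit) = c.1 ∧ ∀ i j, i.val = j.val → r.pos i = c.2 j := by
    rintro _ rfl
    exact ⟨hs, hv⟩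
  obtain ⟨h1, h2⟩ := key _ hx
  exact FinContainer.ext_of_val h1 fun i j hij => h2 _ j hij

theorem dim_coalg_eq {A : Type u} (B C : Type u) (x : T A) :
    (coalg T B x).dim = (coalg T C x).dim := by
  obtain ⟨n, v, g, k, hB, hC, -⟩ := exists_coalg_eq T B C x
  rw [hB, hC]

theorem arity_Phi {A : Type u} (B : Type u) (x : T A) :
    (containerOf T).arity (Phi T x).1 = (coalg T B x).dim :=
  (dim_coalg_peek T PUnit x _).trans (dim_coalg_eq T PUnit B x)

theorem Phi_snd_of_coalg_eq {A B : Type u} {x : T A} {n : ℕ} {v : Fin n → A}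
    {g : (Fin n → B) → T B} (hx : coalg T B x = ⟨n, v, g⟩) (i : Fin n)
    (j : Fin ((containerOf T).arity (Phi T x).1)) (hij : i.val = j.val) :
    (Phi T x).2 j = v i := by
  obtain ⟨m, w, g', k, h1, hB, -⟩ := exists_coalg_eq T PUnit B x
  have key : ∀ (r : FreeApp A PUnit (T PUnit)) (s : FreeApp A B (T B)), r = ⟨m, w, g'⟩ →
      s = ⟨m, w, k⟩ → s = ⟨n, v, g⟩ → ∀ l : Fin r.dim, i.val = l.val → r.pos l = v i := by
    rintro _ _ rfl rfl h l hl
    injection h with hn hv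
    subst hn
    obtain rfl := eq_of_heq hv
    exact congrArg w (Fin.ext hl.symm)
  exact key _ _ h1 hB hx _ hij

theorem Phi_injective (X : Type u) :
    Function.Injective (Phi T : T X → (containerOf T).Ext X) := by
  -- Here `k` is read off the shape alone, and `v` is the vector of `Phi T x`, so `Phi T x`
  -- determines `x = k v`.
  have key : ∀ x : T X, ∃ (n : ℕ) (v : Fin n → X) (k : (Fin n → X) → T X),
      coalg T X (Phi T x).1 = ⟨n, fun _ => PUnit.unit, k⟩ ∧ k v = x ∧
        ∀ i j, i.val = j.val → (Phi T x).2 j = v i := by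
    intro x
    obtain ⟨n, v, g, k, h1, hX, hk⟩ := exists_coalg_eq T PUnit X x
    have hx := peek_pos_coalg T x
    rw [hX] at hx
    have hr : ∀ r : FreeApp X PUnit (T PUnit), r = ⟨n, v, g⟩ →
        r.peek (fun _ => PUnit.unit) = g (fun _ => PUnit.unit) := by
      rintro _ rfl
      rfl
    exact ⟨n, v, k, (congrArg (coalg T X) (hr _ h1)).trans (hk _), hx, Phi_snd_of_coalg_eq T hX⟩
  intro x y hxy
  obtain ⟨n, v, k, h1, hx, hv⟩ := key x
  obtain ⟨m, w, l, h2, hy, hw⟩ := key y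
  rw [← hxy] at h2 hw
  have h := h1.symm.trans h2
  obtain rfl : n = m := congrArg FreeApp.dim h
  injection h with _ _ hkl
  subst hkl
  have har : n = (containerOf T).arity (Phi T x).1 :=
    (congrArg FreeApp.dim h1).symm.trans (dim_coalg_eq T X PUnit _)
  rw [← hx, ← hy]
  congr 1
  funext i
  exact (hv i (Fin.cast har i) rfl).symm.trans (hw i (Fin.cast har i) rfl)

theorem Phi_surjective (X : Type u) :
    Function.Surjective (Phi T : T X → (containerOf T).Ext X) := by
  rintro ⟨s, v⟩
  -- The shape `s` is itself an element of `T PUnit`: `k` refills it with values in `X`, and unity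
  -- at `s` shows that the result has shape `s`.
  obtain ⟨n, u, k, g, hX, h1, hg⟩ := exists_coalg_eq T X PUnit s
  have hs := peek_pos_coalg T s
  have har : (containerOf T).arity s = n := congrArg FreeApp.dim h1
  rw [h1] at hs
  refine ⟨k fun i => v (Fin.cast har.symm i), Phi_eq_of_coalg_eq T (hg _) hs ?_⟩
  exact fun i j hij => congrArg v (Fin.ext hij)

/-- The coalgebras at `PUnit` of `x` and `g bs` share one peek function, whose value at the trivial
vector is the shape. -/
theorem Phi_peek_coalg {A B : Type u} (x : T A) {n : ℕ} {as : Fin n → A}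
    {g : (Fin n → B) → T B} (hx : coalg T B x = ⟨n, as, g⟩)
    (h : n = (containerOf T).arity (Phi T x).1) (bs : Fin n → B) :
    Phi T (g bs) = ⟨(Phi T x).1, fun i => bs (Fin.cast h.symm i)⟩ := by
  obtain ⟨m, as', g', k, hB, h1, hk⟩ := exists_coalg_eq T B PUnit x
  obtain rfl : m = n := congrArg FreeApp.dim (hB.symm.trans hx)
  have e := hB.symm.trans hx
  injection e with _ _ e
  subst e
  refine Phi_eq_of_coalg_eq T (hk bs) ?_ fun i j hij => congrArg bs (Fin.ext hij)
  have key : ∀ r : FreeApp A PUnit (T PUnit), r = ⟨m, as', k⟩ →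
      k (fun _ => PUnit.unit) = r.peek fun _ => PUnit.unit := by
    rintro _ rfl
    rfl
  exact key _ h1

theorem Phi_map_traverse {F : Type u → Type u} [Applicative F] [LawfulApplicative F]
    {A B : Type u} (f : A → F B) (x : T A) :
    Phi T <$> traverse f x = traverse f (Phi T x) := by
  have har := (arity_Phi T B x).symm
  rw [traverse_eq_map_collect, collect_cast f har, Functor.map_map, Functor.map_map]
  have hv : (fun i => (coalg T B x).pos (Fin.cast har.symm i)) = (Phi T x).2 :=
    funext fun i => (Phi_snd_of_coalg_eq T rfl _ i rfl).symm
  rw [hv]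
  refine congrArg (· <$> collect f _ (Phi T x).2) (funext fun ys => ?_)
  exact Phi_peek_coalg T x rfl har _

end Traversal

end TraversableContainer

theorem mainTheorem7 (T : Type u → Type u) [Traversable T] [LawfulTraversable T] :
    (∀ X : Type u, Function.Bijective
      (TraversableContainer.Phi T : T X → (TraversableContainer.containerOf T).Ext X)) ∧
    ∀ (F : Type u → Type u) [Applicative F] [LawfulApplicative F] (A B : Type u)
      (f : A → F B) (x : T A),
      TraversableContainer.Phi T <$> traverse f x = traverse f (TraversableContainer.Phi T x) :=
  ⟨fun X => ⟨TraversableContainer.Phi_injective T X, TraversableContainer.Phi_surjective T X⟩,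
    fun _ _ _ _ _ f x => TraversableContainer.Phi_map_traverse T f x⟩
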